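/- Let $S(\rho)=-\operatorname{tr}[\rho\ln\rho]$ be the von Neumann entropy. For a density matrix $\rho_S$ on $\mathbb C^d$ and $\beta>0$, a $T$-step swap-based Landauer-erasure protocol at inverse temperature $\beta$ is given by a continuously differentiable path $u\mapsto\rho[u]$ ($u\in[0,1]$) of density matrices with $\rho[0]=\rho_S$ and points $0<u_1<\dots<u_T=1$ such that every $\rho[u_t]$ has full rank. Its environment $E$ consists of $T$ subsystems of dimension $d$ with Hamiltonian $H_E=\sum_{t=1}^T H_E^{(t)}\otimes\mathbb 1_{\mathrm{rest}\ne t}$, $H_E^{(t)}=-\frac1\beta\ln\rho[u_t]$, and starts in the thermal state $\tau_E[\beta]=e^{-\beta H_E}/\operatorname{tr}[e^{-\beta H_E}]$. In step $t=1,\dots,T$ the system $S$ is swapped with the $t$-th subsystem of $E$. Let $U$ be the product of these swaps, $\rho'_{SE}=U(\rho_S\otimes\tau_E[\beta])U^\dagger$, $\rho'_S=\operatorname{tr}_E\rho'_{SE}$, $\rho'_E=\operatorname{tr}_S\rho'_{SE}$, $\mathcal Q_E=\operatorname{tr}[H_E(\rho'_E-\tau_E[\beta])]$ (the heat dissipated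 into $E$) and $\Delta S=S(\rho_S)-S(\rho'_S)$. Theorem. For $d\ge2$, $\varepsilon\in(0,1/2]$, $\eta\in(0,1]$ put $$T=\left\lceil\frac{e+1}{e\,\eta}\ln\!\left(\frac{(e+1)(d-1)^2}{\varepsilon\eta}\right)\right\rceil .$$ Then: (i) For every density matrix $\rho_S$ on $\mathbb C^d$, every unit vector $|0\rangle\in\mathbb C^d$ and every $\beta>0$ there is a $T$-step swap-based Landauer-erasure protocol for $\rho_S$ at inverse temperature $\beta$ whose final state satisfies $1-\langle0|\rho'_S|0\rangle\le\varepsilon$ and whose heat satisfies $\beta\mathcal Q_E-\Delta S\le\eta$. (ii) $T=O\!\left(\frac1\eta\log\frac{d^2}{\varepsilon\eta}\right)$, with a constant that does not depend on $d,\varepsilon,\eta$. -/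

import Mathlib

open scoped Matrix Kronecker ComplexOrder

/-- A density matrix: positive semidefinite with unit trace. -/
def IsDensity {n : Type*} [Fintype n] (ρ : Matrix n n ℂ) : Prop :=
  ρ.PosSemidef ∧ ρ.trace = 1

/-- The logarithm of a Hermitian matrix, by functional calculus. -/
noncomputable def matrixLog {n : Type*} [Fintype n] [DecidableEq n]
    (A : Matrix n n ℂ) : Matrix n n ℂ :=
  cfc Real.log A

/-- The von Neumann entropy `-tr[ρ ln ρ]` (natural logarithm, `0 ln 0 = 0`). -/
noncomputable def vonNeumannEntropy {n : Type*} [Fintype n] [DecidableEq n]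
    (ρ : Matrix n n ℂ) : ℝ :=
  -((ρ * matrixLog ρ).trace).re

/-- The thermal state `e^{-βH} / tr[e^{-βH}]`. -/
noncomputable def thermalState {n : Type*} [Fintype n] [DecidableEq n]
    (β : ℝ) (H : Matrix n n ℂ) : Matrix n n ℂ :=
  ((NormedSpace.exp (-((β : ℂ) • H))).trace)⁻¹ • NormedSpace.exp (-((β : ℂ) • H))

/-- The partial trace over the second tensor factor (the environment). -/
def traceEnv {s e : Type*} [Fintype e] (M : Matrix (s × e) (s × e) ℂ) : Matrix s s ℂ :=
  Matrix.of fun i j => ∑ x, M (i, x) (j, x)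

/-- The partial trace over the first tensor factor (the target system). -/
def traceSys {s e : Type*} [Fintype s] (M : Matrix (s × e) (s × e) ℂ) : Matrix e e ℂ :=
  Matrix.of fun x y => ∑ i, M (i, x) (i, y)

/-- The joint state `U (ρ_S ⊗ τ_E[β]) U†` after the unitary `U`. -/
noncomputable def jointFinalState {s e : Type*} [Fintype s] [Fintype e] [DecidableEq e]
    (β : ℝ) (ρS : Matrix s s ℂ) (H : Matrix e e ℂ) (U : Matrix (s × e) (s × e) ℂ) :
    Matrix (s × e) (s × e) ℂ :=
  U * (ρS ⊗ₖ thermalState β H) * Uᴴ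

/-- The heat `tr[H_E (ρ'_E - τ_E[β])]` dissipated into the environment. -/
noncomputable def dissipatedHeat {s e : Type*} [Fintype s] [Fintype e] [DecidableEq e]
    (β : ℝ) (ρS : Matrix s s ℂ) (H : Matrix e e ℂ) (U : Matrix (s × e) (s × e) ℂ) : ℝ :=
  ((H * (traceSys (jointFinalState β ρS H U) - thermalState β H)).trace).re

/-- `A` acting on the `t`-th of `T` subsystems of dimension `d`, tensored with the identity on the
others; the product basis is indexed by `Fin T → Fin d`. -/
def localOp {d T : ℕ} (t : Fin T) (A : Matrix (Fin d) (Fin d) ℂ) :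
    Matrix (Fin T → Fin d) (Fin T → Fin d) ℂ :=
  Matrix.of fun x y => if ∀ r, r ≠ t → x r = y r then A (x t) (y t) else 0

/-- The swap gate between the target system and the `t`-th subsystem of the environment:
`|i⟩ ⊗ |x⟩ ↦ |x_t⟩ ⊗ |x with x_t replaced by i⟩`. -/
def swapGate {d T : ℕ} (t : Fin T) :
    Matrix (Fin d × (Fin T → Fin d)) (Fin d × (Fin T → Fin d)) ℂ :=
  Matrix.of fun a b => if a = (b.2 t, Function.update b.2 t b.1) then 1 else 0

/-- The product `W_T ⋯ W_2 W_1` of the `T` swap gates; `W_1` acts first. -/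
def swapCircuit (d T : ℕ) :
    Matrix (Fin d × (Fin T → Fin d)) (Fin d × (Fin T → Fin d)) ℂ :=
  (List.ofFn fun t : Fin T => swapGate (d := d) t).reverse.prod

/-- A `T`-step swap-based Landauer-erasure protocol for the initial state `ρS`: a continuously
differentiable path of density matrices starting at `ρS`, and points `0 < u_1 < ⋯ < u_T = 1` at
which the path has full rank (so that the path is a thermal state there).
The index `t : Fin T` stands for step `t + 1`. -/
structure SwapErasureProtocol {d : ℕ} (ρS : Matrix (Fin d) (Fin d) ℂ) (T : ℕ) where
  path : ℝ → Matrix (Fin d) (Fin d) ℂ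
  contDiff_path : ∀ i j, ContDiffOn ℝ 1 (fun u => path u i j) (Set.Icc 0 1)
  isDensity_path : ∀ u ∈ Set.Icc (0 : ℝ) 1, IsDensity (path u)
  path_zero : path 0 = ρS
  point : Fin T → ℝ
  point_pos : ∀ t, 0 < point t
  point_strictMono : StrictMono point
  point_last : ∀ t : Fin T, (t : ℕ) + 1 = T → point t = 1
  posDef_path : ∀ t, (path (point t)).PosDef

namespace SwapErasureProtocol

variable {d T : ℕ} {ρS : Matrix (Fin d) (Fin d) ℂ}

/-- The Hamiltonian `-(1/β) ln ρ[u_t]` of the `t`-th subsystem of the environment. -/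
noncomputable def localHamiltonian (P : SwapErasureProtocol ρS T) (β : ℝ) (t : Fin T) :
    Matrix (Fin d) (Fin d) ℂ :=
  (-(1 / β) : ℝ) • matrixLog (P.path (P.point t))

/-- The total Hamiltonian of the environment: the sum of the local ones, without interaction. -/
noncomputable def hamiltonian (P : SwapErasureProtocol ρS T) (β : ℝ) :
    Matrix (Fin T → Fin d) (Fin T → Fin d) ℂ :=
  ∑ t, localOp t (P.localHamiltonian β t)

/-- The final state `ρ'_S` of the target system. -/
noncomputable def finalState (P : SwapErasureProtocol ρS T) (β : ℝ) : Matrix (Fin d) (Fin d) ℂ :=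
  traceEnv (jointFinalState β ρS (P.hamiltonian β) (swapCircuit d T))

/-- The heat dissipated into the environment by the protocol. -/
noncomputable def heat (P : SwapErasureProtocol ρS T) (β : ℝ) : ℝ :=
  dissipatedHeat β ρS (P.hamiltonian β) (swapCircuit d T)

/-- Landauer's bound `ΔS = S(ρ_S) - S(ρ'_S)`. -/
noncomputable def entropyDrop (P : SwapErasureProtocol ρS T) (β : ℝ) : ℝ :=
  vonNeumannEntropy ρS - vonNeumannEntropy (P.finalState β)

end SwapErasureProtocol

/-- The infidelity `1 - ⟨ψ|ρ|ψ⟩` of `ρ` to the pure state `|ψ⟩`. -/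
def infidelity {n : Type*} [Fintype n] (ψ : n → ℂ) (ρ : Matrix n n ℂ) : ℝ :=
  1 - (star ψ ⬝ᵥ (ρ *ᵥ ψ)).re

/-- The number of steps `⌈((e+1)/(eη)) ln((e+1)(d-1)²/(εη))⌉`. -/
noncomputable def erasureSteps (d : ℕ) (ε η : ℝ) : ℕ :=
  ⌈(Real.exp 1 + 1) / (Real.exp 1 * η) *
    Real.log ((Real.exp 1 + 1) * ((d : ℝ) - 1) ^ 2 / (ε * η))⌉₊

/-!
The process is a chain of swaps, so that the system runs through the states
`ρ₀ = ρ_S, ρ₁, …, ρ_T` with `ρ_t = ρ[u_t]`, and the `t`-th subsystem of the environment, prepared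
in the Gibbs state `ρ_t`, is left in `ρ_{t-1}` (`swapCircuit_conj`). The excess heat therefore
telescopes to `β Q - ΔS = ∑ D(ρ_{t-1} ‖ ρ_t)` (`SwapErasureProtocol.excess_heat_eq`).

The path is a segment from `ρ_S` towards a full-rank state `ω` close to `|ψ⟩⟨ψ|`. Two estimates
bound its relative entropies, both from operator monotonicity of the logarithm. The first step, to
weight `v` on `ω`, costs at most `-ln (1 - v)`, even for a singular `ρ_S` (`relEntropy_mix_le`). A
step between weights `u ≤ v` costs at most `(v - u)` times the difference of the log-odds of `v` and
`u` (`relEntropy_segment_le`): Klein's inequality allows one to add the reversed relative entropy,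
and the symmetrized one is a trace against `ln ρ_u - ln ρ_v`. Neither bound refers to `ω` or `d`.

With odds that grow geometrically from `r = η / (e + 1)` to `1 / ε`, the total cost is at most
`r + Λ / (T - 1) * (change of weight)`, where `Λ = ln ((e + 1) / (ε η))`. As the weight changes by
`1 / (1 + ε) - r / (1 + r) < 1`, there is slack to make up for the step spent on the initial mixing,
and the cost stays below `η` (`heat_budget`). The final weight `1 / (1 + ε)` on a state of infidelity
at most `ε ^ 2` leaves a total infidelity of at most `ε`.
-/

/-! ### Product operators on the environment -/

section TensorOp

variable {d T : ℕ}

/-- The product operator `A₁ ⊗ ⋯ ⊗ A_T` in the product basis indexed by `Fin T → Fin d`. -/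
def tensorOp (A : Fin T → Matrix (Fin d) (Fin d) ℂ) :
    Matrix (Fin T → Fin d) (Fin T → Fin d) ℂ :=
  Matrix.of fun x y => ∏ t, A t (x t) (y t)

theorem tensorOp_mul (A B : Fin T → Matrix (Fin d) (Fin d) ℂ) :
    tensorOp A * tensorOp B = tensorOp fun t => A t * B t := by
  ext x y
  simp only [Matrix.mul_apply, tensorOp, Matrix.of_apply, ← Finset.prod_mul_distrib]
  rw [Finset.prod_univ_sum, Fintype.piFinset_univ]

theorem trace_tensorOp (A : Fin T → Matrix (Fin d) (Fin d) ℂ) :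
    (tensorOp A).trace = ∏ t, (A t).trace := by
  simp only [Matrix.trace, Matrix.diag, tensorOp, Matrix.of_apply]
  rw [Finset.prod_univ_sum, Fintype.piFinset_univ]

theorem tensorOp_one : tensorOp (fun _ : Fin T => (1 : Matrix (Fin d) (Fin d) ℂ)) = 1 := by
  ext x y
  simp only [tensorOp, Matrix.of_apply, Matrix.one_apply]
  rw [Fintype.prod_ite_zero]
  simp [funext_iff]

theorem localOp_eq_tensorOp (t : Fin T) (A : Matrix (Fin d) (Fin d) ℂ) :
    localOp t A = tensorOp (Function.update (fun _ => 1) t A) := by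
  ext x y
  simp only [localOp, tensorOp, Matrix.of_apply]
  rw [← Finset.mul_prod_erase _ _ (Finset.mem_univ t), Function.update_self]
  have h : ∀ r ∈ Finset.univ.erase t,
      Function.update (fun _ => (1 : Matrix (Fin d) (Fin d) ℂ)) t A r (x r) (y r)
        = if x r = y r then 1 else 0 := by
    intro r hr
    rw [Function.update_of_ne (Finset.ne_of_mem_erase hr), Matrix.one_apply]
  rw [Finset.prod_congr rfl h, Finset.prod_ite_zero]
  simp

/-- The embedding `localOp t` is a ring homomorphism, so it commutes with the exponential. -/
def localOpHom (t : Fin T) :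
    Matrix (Fin d) (Fin d) ℂ →+* Matrix (Fin T → Fin d) (Fin T → Fin d) ℂ where
  toFun := localOp t
  map_one' := by
    rw [localOp_eq_tensorOp, ← tensorOp_one]
    congr 1
    exact Function.update_eq_self t _
  map_zero' := by
    ext x y
    simp [localOp]
  map_add' A B := by
    ext x y
    simp only [localOp, Matrix.of_apply, Matrix.add_apply]
    split_ifs <;> simp
  map_mul' A B := by
    simp only [localOp_eq_tensorOp, tensorOp_mul]
    congr 1
    ext r : 1
    by_cases h : r = t
    · subst h; simp
    · simp [h]

theorem continuous_localOp (t : Fin T) :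
    Continuous (localOp (d := d) t) := by
  refine continuous_matrix fun x y => ?_
  simp only [localOp, Matrix.of_apply]
  split_ifs
  · fun_prop
  · exact continuous_const

theorem localOp_smul (t : Fin T) (c : ℂ) (A : Matrix (Fin d) (Fin d) ℂ) :
    localOp t (c • A) = c • localOp t A := by
  ext x y
  simp [localOp]

open scoped Matrix.Norms.Operator in
theorem exp_localOp (t : Fin T) (A : Matrix (Fin d) (Fin d) ℂ) :
    NormedSpace.exp (localOp t A) = localOp t (NormedSpace.exp A) :=
  (NormedSpace.map_exp (localOpHom t) (continuous_localOp t) A).symm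

theorem localOp_commute {s t : Fin T} (h : s ≠ t) (A B : Matrix (Fin d) (Fin d) ℂ) :
    Commute (localOp s A) (localOp t B) := by
  unfold Commute SemiconjBy
  simp only [localOp_eq_tensorOp, tensorOp_mul]
  congr 1
  ext r : 1
  by_cases hs : r = s
  · subst hs; simp [h]
  · by_cases ht : r = t
    · subst ht; simp [hs]
    · simp [hs, ht]

/-- The Gibbs operator of a non-interacting Hamiltonian is a product operator. -/
theorem exp_sum_localOp (A : Fin T → Matrix (Fin d) (Fin d) ℂ) :
    NormedSpace.exp (∑ t, localOp t (A t)) = tensorOp fun t => NormedSpace.exp (A t) := by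
  have key : ∀ s : Finset (Fin T), NormedSpace.exp (∑ t ∈ s, localOp t (A t))
      = tensorOp fun t => if t ∈ s then NormedSpace.exp (A t) else 1 := by
    intro s
    induction s using Finset.induction_on with
    | empty => simp [tensorOp_one]
    | insert a s ha ih =>
      have hc : Commute (localOp a (A a)) (∑ t ∈ s, localOp t (A t)) :=
        Commute.sum_right _ _ _ fun i hi =>
          localOp_commute (ne_of_mem_of_not_mem hi ha).symm _ _
      rw [Finset.sum_insert ha, Matrix.exp_add_of_commute _ _ hc, ih, exp_localOp,
        localOp_eq_tensorOp, tensorOp_mul]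
      congr 1
      ext r : 1
      by_cases h : r = a
      · subst h; simp [ha]
      · simp [h]
  simpa using key Finset.univ

theorem trace_localOp_mul_tensorOp (t : Fin T) (A : Matrix (Fin d) (Fin d) ℂ)
    (g : Fin T → Matrix (Fin d) (Fin d) ℂ) (hg : ∀ r, (g r).trace = 1) :
    (localOp t A * tensorOp g).trace = (A * g t).trace := by
  rw [localOp_eq_tensorOp, tensorOp_mul, trace_tensorOp,
    ← Finset.mul_prod_erase _ _ (Finset.mem_univ t), Function.update_self]
  rw [Finset.prod_eq_one, mul_one]
  intro r hr
  rw [Function.update_of_ne (Finset.ne_of_mem_erase hr), one_mul, hg]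

theorem traceEnv_kronecker_tensorOp (A : Matrix (Fin d) (Fin d) ℂ)
    (g : Fin T → Matrix (Fin d) (Fin d) ℂ) (hg : ∀ r, (g r).trace = 1) :
    traceEnv (A ⊗ₖ tensorOp g) = A := by
  have h : (tensorOp g).trace = 1 := by rw [trace_tensorOp]; simp [hg]
  ext i j
  simp only [traceEnv, Matrix.of_apply, Matrix.kroneckerMap_apply, ← Finset.mul_sum]
  simp only [Matrix.trace, Matrix.diag] at h
  rw [h, mul_one]

theorem traceSys_kronecker {s e : Type*} [Fintype s] (A : Matrix s s ℂ) (M : Matrix e e ℂ)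
    (hA : A.trace = 1) : traceSys (A ⊗ₖ M) = M := by
  ext x y
  simp only [traceSys, Matrix.of_apply, Matrix.kroneckerMap_apply, ← Finset.sum_mul]
  simp only [Matrix.trace, Matrix.diag] at hA
  rw [hA, one_mul]

end TensorOp

/-! ### The swap circuit -/

section Swap

variable {d T : ℕ}

/-- A swap gate exchanges the system's factor of a product operator with the `t`-th factor of the
environment. -/
theorem swapGate_conj (t : Fin T) (A : Matrix (Fin d) (Fin d) ℂ)
    (f : Fin T → Matrix (Fin d) (Fin d) ℂ) :
    swapGate t * (A ⊗ₖ tensorOp f) * (swapGate t)ᴴ = f t ⊗ₖ tensorOp (Function.update f t A) := by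
  have hswap : ∀ a b : Fin d × (Fin T → Fin d), a = (b.2 t, Function.update b.2 t b.1) ↔
      b = (a.2 t, Function.update a.2 t a.1) := by
    rintro ⟨i, x⟩ ⟨j, y⟩
    constructor <;> rintro h <;> simp only [Prod.mk.injEq] at h <;> obtain ⟨rfl, rfl⟩ := h <;> simp
  ext a b
  simp only [Matrix.mul_apply, Matrix.conjTranspose_apply, swapGate, Matrix.of_apply, hswap,
    ite_mul, one_mul, zero_mul, Finset.sum_ite_eq', Finset.mem_univ, if_true, apply_ite star,
    star_one, star_zero, mul_ite, mul_one, mul_zero]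
  simp only [Matrix.kroneckerMap_apply, tensorOp, Matrix.of_apply]
  rw [← Finset.mul_prod_erase _ _ (Finset.mem_univ t), ← Finset.mul_prod_erase _ (fun r =>
    Function.update f t A r (a.2 r) (b.2 r)) (Finset.mem_univ t)]
  simp only [Function.update_self]
  rw [mul_left_comm]
  congr 2
  refine Finset.prod_congr rfl fun r hr => ?_
  have hr' := Finset.ne_of_mem_erase hr
  simp [Function.update_of_ne hr']

/-- The swap circuit moves a chain of factors on by one place: the system ends in the last factor,
and the `t`-th subsystem holds what the system held before step `t`. -/
theorem swapCircuit_conj (ρ : ℕ → Matrix (Fin d) (Fin d) ℂ) :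
    swapCircuit d T * (ρ 0 ⊗ₖ tensorOp fun t : Fin T => ρ (t + 1)) * (swapCircuit d T)ᴴ
      = ρ T ⊗ₖ tensorOp fun t : Fin T => ρ t := by
  have key : ∀ (k : ℕ) (hk : k ≤ T),
      (List.ofFn fun t : Fin k => swapGate (d := d) (Fin.castLE hk t)).reverse.prod
        * (ρ 0 ⊗ₖ tensorOp fun t : Fin T => ρ (t + 1))
        * ((List.ofFn fun t : Fin k => swapGate (d := d) (Fin.castLE hk t)).reverse.prod)ᴴ
      = ρ k ⊗ₖ tensorOp fun t : Fin T => if (t : ℕ) < k then ρ t else ρ (t + 1) := by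
    intro k
    induction k with
    | zero => intro hk; simp
    | succ k ih =>
      intro hk
      have ih' := ih (by omega)
      rw [List.ofFn_succ', List.concat_eq_append, List.reverse_append, List.reverse_singleton,
        List.singleton_append, List.prod_cons, Matrix.conjTranspose_mul]
      have e : (fun i : Fin k => swapGate (d := d) (Fin.castLE hk i.castSucc))
          = fun t : Fin k => swapGate (d := d) (Fin.castLE (by omega : k ≤ T) t) := rfl
      rw [e]
      have assoc : ∀ G P M : Matrix (Fin d × (Fin T → Fin d)) (Fin d × (Fin T → Fin d)) ℂ,
          G * P * M * (Pᴴ * Gᴴ) = G * (P * M * Pᴴ) * Gᴴ := by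
        intro G P M
        simp only [Matrix.mul_assoc]
      rw [assoc, ih', swapGate_conj]
      congr 1
      · simp
      · congr 1
        ext r : 1
        by_cases h : (r : ℕ) = k
        · have hr : r = Fin.castLE hk (Fin.last k) := Fin.ext h
          subst hr
          simp
        · have hr : r ≠ Fin.castLE hk (Fin.last k) := fun h' => h (by rw [h']; rfl)
          rw [Function.update_of_ne hr]
          have : (r : ℕ) < k ↔ (r : ℕ) < k + 1 := by omega
          simp [this]
  have := key T le_rfl
  simpa [swapCircuit] using this

end Swap

/-! ### Operator monotonicity and traces -/

section Operator

open scoped MatrixOrder Matrix.Norms.L2Operator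

variable {n : Type*} [Fintype n] [DecidableEq n]

theorem matrixLog_le_matrixLog {A B : Matrix n n ℂ} (hA : A.PosDef) (h : A ≤ B) :
    matrixLog A ≤ matrixLog B :=
  CFC.log_le_log h hA.isStrictlyPositive

theorem exp_matrixLog {A : Matrix n n ℂ} (hA : A.PosDef) :
    NormedSpace.exp (matrixLog A) = A :=
  CFC.exp_log A hA.isStrictlyPositive

theorem matrixLog_smul {A : Matrix n n ℂ} (hA : A.PosDef) {c : ℝ} (hc : 0 < c) :
    matrixLog (c • A) = (Real.log c) • (1 : Matrix n n ℂ) + matrixLog A := by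
  have h := CFC.log_smul' A hc hA.isStrictlyPositive
  rw [Algebra.algebraMap_eq_smul_one] at h
  exact h

theorem trace_mul_nonneg_of_posSemidef {A B : Matrix n n ℂ} (hA : A.PosSemidef)
    (hB : B.PosSemidef) : 0 ≤ (A * B).trace := by
  obtain ⟨X, hX⟩ := CStarAlgebra.nonneg_iff_eq_star_mul_self.mp hA.nonneg
  rw [hX, Matrix.mul_assoc, Matrix.trace_mul_comm]
  exact (hB.mul_mul_conjTranspose_same X).trace_nonneg

theorem re_trace_mul_le_re_trace_mul {A B C : Matrix n n ℂ} (hA : A.PosSemidef) (h : B ≤ C) :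
    ((A * B).trace).re ≤ ((A * C).trace).re := by
  have h0 := trace_mul_nonneg_of_posSemidef hA (Matrix.le_iff.mp h)
  rw [Matrix.mul_sub, Matrix.trace_sub] at h0
  have h1 := (Complex.le_def.mp h0).1
  simp only [Complex.zero_re, Complex.sub_re] at h1
  linarith

/-- The expansion of `tr[f(A) g(B)]` in the eigenbases of `A` and `B`, with the squared overlaps of
the eigenvectors as weights. It reduces trace inequalities to scalar ones, although `A` and `B` need
not commute. -/
theorem exists_weights_re_trace_cfc_mul_cfc {A B : Matrix n n ℂ} (hA : A.IsHermitian)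
    (hB : B.IsHermitian) :
    ∃ w : n → n → ℝ, (∀ i j, 0 ≤ w i j) ∧ ∀ f g : ℝ → ℝ,
      ((cfc f A * cfc g B).trace).re
        = ∑ i, ∑ j, w i j * (f (hA.eigenvalues i) * g (hB.eigenvalues j)) := by
  set U : Matrix n n ℂ := (hA.eigenvectorUnitary).1
  set V : Matrix n n ℂ := (hB.eigenvectorUnitary).1
  refine ⟨fun i j => Complex.normSq ((Uᴴ * V) i j), fun i j => Complex.normSq_nonneg _,
    fun f g => ?_⟩
  rw [hA.cfc_eq, hB.cfc_eq]
  have e : ∀ D E : Matrix n n ℂ, ((U * D * Uᴴ) * (V * E * Vᴴ)).trace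
      = (D * (Uᴴ * V) * E * (Uᴴ * V)ᴴ).trace := by
    intro D E
    rw [Matrix.conjTranspose_mul, Matrix.conjTranspose_conjTranspose, ← Matrix.mul_assoc _ Vᴴ U,
      Matrix.trace_mul_comm _ U]
    simp only [Matrix.mul_assoc]
  have e' : (hA.cfc f * hB.cfc g).trace = _ :=
    e (Matrix.diagonal (RCLike.ofReal ∘ f ∘ hA.eigenvalues))
      (Matrix.diagonal (RCLike.ofReal ∘ g ∘ hB.eigenvalues))
  rw [e']
  generalize Uᴴ * V = X
  simp only [Matrix.trace, Matrix.diag, Matrix.mul_apply (N := Xᴴ), Matrix.mul_diagonal,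
    Matrix.diagonal_mul, Matrix.conjTranspose_apply, Complex.re_sum]
  refine Finset.sum_congr rfl fun i _ => Finset.sum_congr rfl fun j _ => ?_
  have hz : ∀ (z : ℂ) (a b : ℝ), ((a : ℂ) * z * (b : ℂ) * star z).re
      = Complex.normSq z * (a * b) := by
    intro z a b
    simp [Complex.normSq_apply]
    ring
  exact hz _ _ _

theorem re_trace_cfc {A : Matrix n n ℂ} (hA : A.IsHermitian) (f : ℝ → ℝ) :
    ((cfc f A).trace).re = ∑ i, f (hA.eigenvalues i) := by
  rw [hA.cfc_eq, Matrix.IsHermitian.cfc, Unitary.conjStarAlgAut_apply, Matrix.mul_assoc,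
    Matrix.trace_mul_comm, Matrix.mul_assoc, Unitary.coe_star_mul_self, mul_one,
    Matrix.trace_diagonal]
  simp

theorem continuousOn_spectrum (A : Matrix n n ℂ) (f : ℝ → ℝ) :
    ContinuousOn f (spectrum ℝ A) :=
  (Matrix.finite_real_spectrum (A := A)).continuousOn f

end Operator

/-! ### Quantum relative entropy -/

section RelativeEntropy

open scoped MatrixOrder Matrix.Norms.L2Operator

variable {n : Type*} [Fintype n] [DecidableEq n]

/-- The quantum relative entropy `D(ρ‖σ) = tr[ρ (ln ρ - ln σ)]`, which is meaningful for `σ` of full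
rank. -/
noncomputable def relEntropy (ρ σ : Matrix n n ℂ) : ℝ :=
  ((ρ * matrixLog ρ).trace).re - ((ρ * matrixLog σ).trace).re

/-- **Klein's inequality**. -/
theorem relEntropy_nonneg {ρ σ : Matrix n n ℂ} (hρ : ρ.PosSemidef) (hσ : σ.PosDef)
    (h : ρ.trace = σ.trace) : 0 ≤ relEntropy ρ σ := by
  obtain ⟨w, hw, H⟩ := exists_weights_re_trace_cfc_mul_cfc hρ.1 hσ.1
  have hid : cfc (fun x : ℝ => x) ρ = ρ := cfc_id' ℝ ρ hρ.1
  have hid' : cfc (fun x : ℝ => x) σ = σ := cfc_id' ℝ σ hσ.1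
  have h1 : cfc (fun _ : ℝ => (1 : ℝ)) ρ = 1 := cfc_const_one ℝ ρ hρ.1
  have h1' : cfc (fun _ : ℝ => (1 : ℝ)) σ = 1 := cfc_const_one ℝ σ hσ.1
  have hmul : cfc (fun x : ℝ => x * Real.log x) ρ = ρ * matrixLog ρ := by
    rw [cfc_mul (fun x : ℝ => x) Real.log ρ (continuousOn_spectrum _ _)
      (continuousOn_spectrum _ _), hid, matrixLog]
  have e1 := H (fun x => x * Real.log x) (fun _ => 1)
  have e2 := H (fun x => x) Real.log
  have e3 := H (fun x => x) (fun _ => 1)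
  have e4 := H (fun _ => 1) (fun x => x)
  rw [hmul, h1', mul_one] at e1
  rw [hid] at e2
  rw [hid, h1', mul_one] at e3
  rw [hid', h1, one_mul, ← h] at e4
  have e5 : 0 ≤ ∑ i, ∑ j, w i j * ((hρ.1.eigenvalues i * Real.log (hρ.1.eigenvalues i) * 1
      - hρ.1.eigenvalues i * Real.log (hσ.1.eigenvalues j))
      - (hρ.1.eigenvalues i * 1 - 1 * hσ.1.eigenvalues j)) := by
    refine Finset.sum_nonneg fun i _ => Finset.sum_nonneg fun j _ => mul_nonneg (hw i j) ?_
    have ha := hρ.eigenvalues_nonneg i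
    have hb := hσ.eigenvalues_pos j
    generalize hρ.1.eigenvalues i = a at *
    generalize hσ.1.eigenvalues j = b at *
    rcases ha.eq_or_lt with rfl | ha
    · simp [hb.le]
    · have hl := Real.log_le_sub_one_of_pos (div_pos hb ha)
      rw [Real.log_div hb.ne' ha.ne'] at hl
      have := mul_le_mul_of_nonneg_left hl ha.le
      rw [mul_sub, mul_sub, mul_div_cancel₀ _ ha.ne'] at this
      linarith
  simp only [mul_sub, Finset.sum_sub_distrib] at e5
  simp only [relEntropy, matrixLog] at *
  linarith

/-- Mixing `ρ` with a full-rank state costs at most `-ln (1 - v)`, even if `ρ` is singular: the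
mixture dominates `(1 - v) ρ + κ 1` for some `κ > 0`, which commutes with `ρ`. -/
theorem relEntropy_mix_le {ρ ω : Matrix n n ℂ} (hρ : IsDensity ρ) {δ : ℝ} (hδ : 0 < δ)
    (hω : δ • (1 : Matrix n n ℂ) ≤ ω) {v : ℝ} (hv0 : 0 < v) (hv1 : v < 1) :
    relEntropy ρ ((1 - v) • ρ + v • ω) ≤ -Real.log (1 - v) := by
  obtain ⟨hρ, htr⟩ := hρ
  set κ := v * δ with hκ
  have hκ0 : 0 < κ := mul_pos hv0 hδ
  have hid : cfc (fun x : ℝ => x) ρ = ρ := cfc_id' ℝ ρ hρ.1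
  have haff : cfc (fun x : ℝ => (1 - v) * x + κ) ρ = (1 - v) • ρ + κ • (1 : Matrix n n ℂ) := by
    rw [cfc_add ρ (fun x => (1 - v) * x) (fun _ => κ) (continuousOn_spectrum _ _)
      (continuousOn_spectrum _ _), cfc_const_mul (1 - v) (fun x => x) ρ (continuousOn_spectrum _ _),
      hid]
    exact congrArg _ ((cfc_const κ ρ hρ.1).trans (Algebra.algebraMap_eq_smul_one κ))
  have hpd : ((1 - v) • ρ + κ • (1 : Matrix n n ℂ)).PosDef :=
    Matrix.PosDef.posSemidef_add (hρ.smul (by linarith)) (Matrix.PosDef.one.smul hκ0)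
  have hle : (1 - v) • ρ + κ • (1 : Matrix n n ℂ) ≤ (1 - v) • ρ + v • ω := by
    rw [Matrix.le_iff]
    have := (Matrix.le_iff.mp hω).smul hv0.le
    convert this using 1
    rw [smul_sub, hκ, mul_smul]
    abel
  have hlog : matrixLog ((1 - v) • ρ + κ • (1 : Matrix n n ℂ))
      = cfc (fun x => Real.log ((1 - v) * x + κ)) ρ := by
    rw [← haff]
    exact (cfc_comp' Real.log (fun x => (1 - v) * x + κ) ρ
      (((Matrix.finite_real_spectrum (A := ρ)).image _).continuousOn _)
      (continuousOn_spectrum _ _) hρ.1).symm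
  have h1 := re_trace_mul_le_re_trace_mul hρ (matrixLog_le_matrixLog hpd hle)
  have hmul : ∀ f : ℝ → ℝ, ((ρ * cfc f ρ).trace).re
      = ∑ i, hρ.1.eigenvalues i * f (hρ.1.eigenvalues i) := by
    intro f
    rw [← re_trace_cfc hρ.1 (fun x => x * f x), cfc_mul (fun x : ℝ => x) f ρ
      (continuousOn_spectrum _ _) (continuousOn_spectrum _ _), hid]
  have hsum : ∑ i, hρ.1.eigenvalues i = 1 := by
    have := re_trace_cfc hρ.1 (fun x => x)
    rw [hid, htr, Complex.one_re] at this
    exact this.symm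
  rw [hlog, hmul] at h1
  have h2 : ∑ i, hρ.1.eigenvalues i * (Real.log (1 - v) + Real.log (hρ.1.eigenvalues i))
      ≤ ∑ i, hρ.1.eigenvalues i * Real.log ((1 - v) * hρ.1.eigenvalues i + κ) := by
    refine Finset.sum_le_sum fun i _ => ?_
    have ha := hρ.eigenvalues_nonneg i
    generalize hρ.1.eigenvalues i = a at *
    rcases ha.eq_or_lt with rfl | ha
    · simp
    · have hv : 0 < 1 - v := by linarith
      rw [← Real.log_mul hv.ne' ha.ne']
      exact mul_le_mul_of_nonneg_left
        (Real.log_le_log (mul_pos hv ha) (by linarith)) ha.le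
  simp only [mul_add, Finset.sum_add_distrib, ← Finset.sum_mul, hsum, one_mul] at h2
  have h3 := hmul Real.log
  simp only [relEntropy]
  rw [show ((ρ * matrixLog ρ).trace).re = _ from h3]
  linarith

theorem re_trace_mul_matrixLog_sub_le {ρ A B : Matrix n n ℂ} (hρ : IsDensity ρ) (hA : A.PosDef)
    (hB : B.PosDef) {c : ℝ} (hc : 0 < c) (h : A ≤ c • B) :
    ((ρ * matrixLog A).trace).re - ((ρ * matrixLog B).trace).re ≤ Real.log c := by
  have h1 := re_trace_mul_le_re_trace_mul hρ.1 (matrixLog_le_matrixLog hA h)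
  rw [matrixLog_smul hB hc, Matrix.mul_add, Matrix.trace_add, Matrix.mul_smul, mul_one,
    Matrix.trace_smul, hρ.2, Complex.add_re] at h1
  simp at h1
  linarith

/-- For two points of a segment of states even the symmetrized relative entropy satisfies this bound,
by operator monotonicity of the logarithm; the reversed term is dropped by Klein's inequality. -/
theorem relEntropy_segment_le {ρ ω : Matrix n n ℂ} (hρ : IsDensity ρ) (hω : IsDensity ω)
    (hω' : ω.PosDef) {u v : ℝ} (hu : 0 < u) (huv : u ≤ v) (hv : v < 1) :
    relEntropy ((1 - u) • ρ + u • ω) ((1 - v) • ρ + v • ω)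
      ≤ (v - u) * (Real.log (v / (1 - v)) - Real.log (u / (1 - u))) := by
  have hpd : ∀ x : ℝ, 0 < x → x < 1 → ((1 - x) • ρ + x • ω).PosDef := fun x h0 h1 =>
    Matrix.PosDef.posSemidef_add (hρ.1.smul (by linarith)) (hω'.smul h0)
  have htr : ∀ x : ℝ, ((1 - x) • ρ + x • ω).trace = 1 := by
    intro x
    rw [Matrix.trace_add, Matrix.trace_smul, Matrix.trace_smul, hρ.2, hω.2, ← add_smul]
    simp
  have hv0 : 0 < v := hu.trans_le huv
  have hu1 : u < 1 := huv.trans_lt hv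
  have hA := hpd u hu hu1
  have hB := hpd v hv0 hv
  have hu' : (1 - u) ≠ 0 := by linarith
  have hv' : (1 - v) ≠ 0 := by linarith
  have hAB : (1 - u) • ρ + u • ω ≤ ((1 - u) / (1 - v)) • ((1 - v) • ρ + v • ω) := by
    have e1 : (1 - u) / (1 - v) * (1 - v) = 1 - u := by field_simp
    have e2 : (1 - u) / (1 - v) * v = u + (v - u) / (1 - v) := by field_simp; ring
    have e : ((1 - u) / (1 - v)) • ((1 - v) • ρ + v • ω) - ((1 - u) • ρ + u • ω)
        = ((v - u) / (1 - v)) • ω := by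
      rw [smul_add, smul_smul, smul_smul, e1, e2, add_smul]
      abel
    rw [Matrix.le_iff, e]
    exact hω.1.smul (div_nonneg (by linarith) (by linarith))
  have hBA : (1 - v) • ρ + v • ω ≤ (v / u) • ((1 - u) • ρ + u • ω) := by
    have e1 : v / u * (1 - u) = (1 - v) + (v - u) / u := by field_simp; ring
    have e2 : v / u * u = v := by field_simp
    have e : (v / u) • ((1 - u) • ρ + u • ω) - ((1 - v) • ρ + v • ω) = ((v - u) / u) • ρ := by
      rw [smul_add, smul_smul, smul_smul, e1, e2, add_smul]
      abel
    rw [Matrix.le_iff, e]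
    exact hρ.1.smul (div_nonneg (by linarith) (by linarith))
  have hK := relEntropy_nonneg hB.posSemidef hA ((htr v).trans (htr u).symm)
  have h1 := re_trace_mul_matrixLog_sub_le hρ hA hB (div_pos (by linarith) (by linarith)) hAB
  have h2 := re_trace_mul_matrixLog_sub_le hω hB hA (div_pos hv0 hu) hBA
  have hlin : ∀ (x : ℝ) (M : Matrix n n ℂ), ((((1 - x) • ρ + x • ω) * M).trace).re
      = (1 - x) * ((ρ * M).trace).re + x * ((ω * M).trace).re := by
    intro x M
    rw [Matrix.add_mul, Matrix.trace_add, Matrix.smul_mul, Matrix.smul_mul, Matrix.trace_smul,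
      Matrix.trace_smul, Complex.add_re, Complex.smul_re, Complex.smul_re, smul_eq_mul, smul_eq_mul]
  simp only [relEntropy, hlin] at hK ⊢
  rw [Real.log_div (by linarith) (by linarith)] at h1
  rw [Real.log_div (by linarith) (by linarith)] at h2
  rw [Real.log_div (by linarith) (by linarith), Real.log_div (by linarith) (by linarith)]
  have h3 := mul_le_mul_of_nonneg_left (add_le_add h1 h2) (sub_nonneg.mpr huv)
  nlinarith

end RelativeEntropy

/-! ### The dissipation of a swap protocol -/

namespace SwapErasureProtocol

variable {d T : ℕ} {ρS : Matrix (Fin d) (Fin d) ℂ}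

theorem thermalState_hamiltonian (P : SwapErasureProtocol ρS T) {β : ℝ} (hβ : 0 < β) :
    thermalState β (P.hamiltonian β) = tensorOp fun t => P.path (P.point t) := by
  have hexp : NormedSpace.exp (-((β : ℂ) • P.hamiltonian β))
      = tensorOp fun t => P.path (P.point t) := by
    have h : -((β : ℂ) • P.hamiltonian β)
        = ∑ t, localOp t (matrixLog (P.path (P.point t))) := by
      simp only [hamiltonian, Finset.smul_sum, ← Finset.sum_neg_distrib]
      refine Finset.sum_congr rfl fun t _ => ?_
      rw [← localOp_smul, ← neg_one_smul ℂ, ← localOp_smul, localHamiltonian]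
      congr 1
      ext i j
      have : (β : ℂ) ≠ 0 := by exact_mod_cast hβ.ne'
      simp only [Matrix.smul_apply, Complex.real_smul, smul_eq_mul]
      push_cast
      field_simp
    rw [h, exp_sum_localOp]
    simp only [exp_matrixLog (P.posDef_path _)]
  have htr : (tensorOp fun t => P.path (P.point t)).trace = 1 := by
    rw [trace_tensorOp]
    refine Finset.prod_eq_one fun t _ => (P.isDensity_path _ ⟨(P.point_pos t).le, ?_⟩).2
    have hT : T - 1 < T := by have := t.2; omega
    rw [← P.point_last ⟨T - 1, hT⟩ (by simp only; omega)]
    exact P.point_strictMono.monotone (Fin.le_def.mpr (by simp only; omega))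
  rw [thermalState, hexp, htr, inv_one, one_smul]

variable {P : SwapErasureProtocol ρS T} {σ : ℕ → Matrix (Fin d) (Fin d) ℂ}

theorem jointFinalState_eq {β : ℝ} (hβ : 0 < β) (h0 : σ 0 = ρS)
    (hσ : ∀ t : Fin T, P.path (P.point t) = σ (t + 1)) :
    jointFinalState β ρS (P.hamiltonian β) (swapCircuit d T)
      = σ T ⊗ₖ tensorOp fun t : Fin T => σ t := by
  have h := swapCircuit_conj (T := T) σ
  rw [h0] at h
  rw [jointFinalState, P.thermalState_hamiltonian hβ, ← h]
  simp only [hσ]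

theorem finalState_eq {β : ℝ} (hβ : 0 < β) (h0 : σ 0 = ρS)
    (hσ : ∀ t : Fin T, P.path (P.point t) = σ (t + 1)) (htr : ∀ k, (σ k).trace = 1) :
    P.finalState β = σ T := by
  rw [finalState, jointFinalState_eq hβ h0 hσ, traceEnv_kronecker_tensorOp _ _ fun r => htr r]

theorem beta_mul_heat_eq {β : ℝ} (hβ : 0 < β) (h0 : σ 0 = ρS)
    (hσ : ∀ t : Fin T, P.path (P.point t) = σ (t + 1)) (htr : ∀ k, (σ k).trace = 1) :
    β * P.heat β = ∑ k ∈ Finset.range T, (((σ (k + 1) * matrixLog (σ (k + 1))).trace).re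
      - ((σ k * matrixLog (σ (k + 1))).trace).re) := by
  rw [heat, dissipatedHeat, jointFinalState_eq hβ h0 hσ, P.thermalState_hamiltonian hβ,
    traceSys_kronecker _ _ (htr T), hamiltonian, Matrix.mul_sub, Matrix.sum_mul, Matrix.sum_mul,
    ← Finset.sum_sub_distrib, Matrix.trace_sum, Complex.re_sum, Finset.mul_sum,
    ← Fin.sum_univ_eq_sum_range (fun k => ((σ (k + 1) * matrixLog (σ (k + 1))).trace).re
      - ((σ k * matrixLog (σ (k + 1))).trace).re)]
  refine Finset.sum_congr rfl fun t _ => ?_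
  rw [Matrix.trace_sub, trace_localOp_mul_tensorOp _ _ _ fun r => htr r,
    trace_localOp_mul_tensorOp _ _ _ fun r => by rw [hσ]; exact htr _, localHamiltonian, hσ,
    Matrix.smul_mul, Matrix.smul_mul, Matrix.trace_smul, Matrix.trace_smul,
    Matrix.trace_mul_comm _ (σ t), Matrix.trace_mul_comm _ (σ (t + 1)), Complex.sub_re,
    Complex.smul_re, Complex.smul_re, smul_eq_mul, smul_eq_mul]
  field_simp
  ring

/-- The heat in excess of Landauer's bound is the sum of the relative entropies between consecutive
states of the system. -/
theorem excess_heat_eq {β : ℝ} (hβ : 0 < β) (h0 : σ 0 = ρS)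
    (hσ : ∀ t : Fin T, P.path (P.point t) = σ (t + 1)) (htr : ∀ k, (σ k).trace = 1) :
    β * P.heat β - P.entropyDrop β
      = ∑ k ∈ Finset.range T, relEntropy (σ k) (σ (k + 1)) := by
  have htel := Finset.sum_range_sub (fun k => ((σ k * matrixLog (σ k)).trace).re) T
  rw [beta_mul_heat_eq hβ h0 hσ htr, entropyDrop, finalState_eq hβ h0 hσ htr, vonNeumannEntropy,
    vonNeumannEntropy, ← h0]
  simp only [Finset.sum_sub_distrib, relEntropy] at htel ⊢
  linarith

end SwapErasureProtocol

/-! ### Protocols along a segment of states -/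

section Segment

variable {d : ℕ} {ρ ω : Matrix (Fin d) (Fin d) ℂ}

theorem isDensity_segment (hρ : IsDensity ρ) (hω : IsDensity ω) {x : ℝ} (h0 : 0 ≤ x) (h1 : x ≤ 1) :
    IsDensity ((1 - x) • ρ + x • ω) := by
  refine ⟨(hρ.1.smul (by linarith)).add (hω.1.smul h0), ?_⟩
  rw [Matrix.trace_add, Matrix.trace_smul, Matrix.trace_smul, hρ.2, hω.2, ← add_smul]
  simp

theorem posDef_segment (hρ : IsDensity ρ) (hω : ω.PosDef) {x : ℝ} (h0 : 0 < x) (h1 : x ≤ 1) :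
    ((1 - x) • ρ + x • ω).PosDef :=
  Matrix.PosDef.posSemidef_add (hρ.1.smul (by linarith)) (hω.smul h0)

/-- The protocol that runs along the segment from `ρ` towards the full-rank state `ω`, with weight
`q k` on `ω` after `k + 1` steps. -/
noncomputable def segmentProtocol (hρ : IsDensity ρ) (hω : IsDensity ω) (hω' : ω.PosDef) (m : ℕ)
    (q : ℕ → ℝ) (hq0 : ∀ k, 0 < q k) (hq1 : ∀ k, q k ≤ 1) (hq : StrictMono q) :
    SwapErasureProtocol ρ (m + 1) where
  path u := (1 - q m * u) • ρ + (q m * u) • ω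
  contDiff_path i j := by
    simp only [Matrix.add_apply, Matrix.smul_apply, Complex.real_smul]
    have h : ContDiff ℝ 1 fun u : ℝ => (u : ℂ) := Complex.ofRealCLM.contDiff
    have h' : ContDiff ℝ 1 fun u : ℝ => (1 - (q m : ℂ) * (u : ℂ)) * ρ i j
        + ((q m : ℂ) * (u : ℂ)) * ω i j := by fun_prop
    push_cast
    exact h'.contDiffOn
  isDensity_path u hu := isDensity_segment hρ hω (mul_nonneg (hq0 m).le hu.1)
    (mul_le_one₀ (hq1 m) hu.1 hu.2)
  path_zero := by simp
  point t := q t / q m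
  point_pos t := div_pos (hq0 _) (hq0 _)
  point_strictMono _ _ h := div_lt_div_of_pos_right (hq h) (hq0 m)
  point_last t ht := by
    rw [show (t : ℕ) = m by omega, div_self (hq0 m).ne']
  posDef_path t := by
    rw [mul_div_cancel₀ _ (hq0 m).ne']
    exact posDef_segment hρ hω' (hq0 _) (hq1 _)

/-- If the odds of the weights start at `r` and grow by the factor `exp lam` in every step, then the
excess heat is at most `r` for the first step, plus `lam` times the remaining change of weight. -/
theorem exists_protocol_of_geometric_odds (hρ : IsDensity ρ) (hω : IsDensity ω) (hω' : ω.PosDef)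
    {δ : ℝ} (hδ : 0 < δ) (hδω : (ω - δ • (1 : Matrix (Fin d) (Fin d) ℂ)).PosSemidef) (m : ℕ)
    {r lam β : ℝ} (hr : 0 < r) (hlam : 0 < lam) (hβ : 0 < β) {v : ℝ}
    (hv : v / (1 - v) = r * Real.exp (lam * m)) (hv1 : v < 1) :
    ∃ P : SwapErasureProtocol ρ (m + 1), P.finalState β = (1 - v) • ρ + v • ω ∧
      β * P.heat β - P.entropyDrop β ≤ r + lam * (v - r / (1 + r)) := by
  set s : ℕ → ℝ := fun k => r * Real.exp (lam * k) with hs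
  have hs0 : ∀ k, 0 < s k := fun k => mul_pos hr (Real.exp_pos _)
  have hsm : StrictMono s := by
    intro a b hab
    have : (a : ℝ) < b := by exact_mod_cast hab
    exact mul_lt_mul_of_pos_left (Real.exp_lt_exp.mpr (mul_lt_mul_of_pos_left this hlam)) hr
  set q : ℕ → ℝ := fun k => s k / (1 + s k) with hqdef
  have hq0 : ∀ k, 0 < q k := fun k => div_pos (hs0 k) (by linarith [hs0 k])
  have hq1 : ∀ k, q k < 1 := fun k => (div_lt_one (by linarith [hs0 k])).mpr (by linarith)
  have hqm : StrictMono q := by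
    intro a b hab
    have h := hsm hab
    have ha := hs0 a
    have hb := hs0 b
    simp only [hqdef]
    rw [div_lt_div_iff₀ (by linarith) (by linarith)]
    nlinarith
  have hodds : ∀ k, q k / (1 - q k) = s k := by
    intro k
    have := hs0 k
    have h1 : 1 + s k ≠ 0 := by linarith
    have h2 : 1 - q k = 1 / (1 + s k) := by simp only [hqdef]; field_simp; ring
    rw [h2]
    simp only [hqdef]
    field_simp
  have hqmv : q m = v := by
    have h := hv
    rw [div_eq_iff (by linarith)] at h
    have hsm' : r * Real.exp (lam * m) = s m := rfl
    rw [hsm'] at h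
    have := hs0 m
    simp only [hqdef]
    rw [div_eq_iff (by linarith)]
    linarith
  have hlog : ∀ k, Real.log (q k / (1 - q k)) = Real.log r + lam * k := by
    intro k
    rw [hodds, hs, Real.log_mul hr.ne' (Real.exp_pos _).ne', Real.log_exp]
  let σ : ℕ → Matrix (Fin d) (Fin d) ℂ := fun k =>
    Nat.casesOn k ρ fun k => (1 - q k) • ρ + q k • ω
  let P := segmentProtocol hρ hω hω' m q hq0 (fun k => (hq1 k).le) hqm
  have hσ : ∀ t : Fin (m + 1), P.path (P.point t) = σ (t + 1) := by
    intro t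
    change (1 - q m * (q t / q m)) • ρ + (q m * (q t / q m)) • ω = (1 - q t) • ρ + q t • ω
    rw [mul_div_cancel₀ _ (hq0 m).ne']
  have htr : ∀ k, (σ k).trace = 1 := by
    intro k
    cases k with
    | zero => exact hρ.2
    | succ k => exact (isDensity_segment hρ hω (hq0 k).le (hq1 k).le).2
  refine ⟨P, ?_, ?_⟩
  · rw [SwapErasureProtocol.finalState_eq hβ rfl hσ htr, ← hqmv]
  · rw [SwapErasureProtocol.excess_heat_eq hβ rfl hσ htr, Finset.sum_range_succ', add_comm]
    refine add_le_add ?_ ?_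
    · refine (relEntropy_mix_le hρ hδ hδω (hq0 0) (hq1 0)).trans ?_
      have h1 : 1 - q 0 = (1 + r)⁻¹ := by
        have hs00 : s 0 = r := by simp [hs]
        simp only [hqdef, hs00]
        field_simp
        ring
      rw [h1, Real.log_inv, neg_neg]
      linarith [Real.log_le_sub_one_of_pos (show 0 < 1 + r by linarith)]
    · have hstep : ∀ k ∈ Finset.range m, relEntropy (σ (k + 1)) (σ (k + 1 + 1))
          ≤ lam * (q (k + 1) - q k) := by
        intro k _
        refine (relEntropy_segment_le hρ hω hω' (hq0 k) (hqm (Nat.lt_succ_self k)).le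
          (hq1 (k + 1))).trans (le_of_eq ?_)
        rw [hlog, hlog]
        push_cast
        ring
      refine (Finset.sum_le_sum hstep).trans (le_of_eq ?_)
      rw [← Finset.mul_sum, Finset.sum_range_sub, hqmv]
      simp [hqdef, hs]

/-- The target state `κ 1 / d + (1 - κ) |ψ⟩⟨ψ|`: a full-rank perturbation of `|ψ⟩`. -/
noncomputable def noisyState (d : ℕ) (κ : ℝ) (ψ : Fin d → ℂ) : Matrix (Fin d) (Fin d) ℂ :=
  (κ / d) • (1 : Matrix (Fin d) (Fin d) ℂ) + (1 - κ) • Matrix.vecMulVec ψ (star ψ)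

theorem noisyState_sub_posSemidef {κ : ℝ} (hκ : κ ≤ 1) (ψ : Fin d → ℂ) :
    (noisyState d κ ψ - (κ / d) • (1 : Matrix (Fin d) (Fin d) ℂ)).PosSemidef := by
  rw [noisyState, add_sub_cancel_left]
  exact (Matrix.posSemidef_vecMulVec_self_star ψ).smul (by linarith)

theorem noisyState_posDef (hd : 0 < d) {κ : ℝ} (hκ0 : 0 < κ) (hκ : κ ≤ 1) (ψ : Fin d → ℂ) :
    (noisyState d κ ψ).PosDef :=
  (Matrix.PosDef.one.smul (div_pos hκ0 (by exact_mod_cast hd))).add_posSemidef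
    ((Matrix.posSemidef_vecMulVec_self_star ψ).smul (by linarith))

theorem noisyState_isDensity (hd : 0 < d) {κ : ℝ} (hκ0 : 0 < κ) (hκ : κ ≤ 1) {ψ : Fin d → ℂ}
    (hψ : star ψ ⬝ᵥ ψ = 1) : IsDensity (noisyState d κ ψ) := by
  refine ⟨(noisyState_posDef hd hκ0 hκ ψ).posSemidef, ?_⟩
  have hd' : (d : ℂ) ≠ 0 := by exact_mod_cast hd.ne'
  rw [noisyState, Matrix.trace_add, Matrix.trace_smul, Matrix.trace_smul, Matrix.trace_one,
    Matrix.trace_vecMulVec, dotProduct_comm, hψ]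
  simp only [Fintype.card_fin, Complex.real_smul]
  push_cast
  field_simp
  ring

theorem infidelity_segment_noisyState_le {κ : ℝ} (hκ0 : 0 ≤ κ) {ψ : Fin d → ℂ}
    (hψ : star ψ ⬝ᵥ ψ = 1) (hρ : IsDensity ρ) {v : ℝ} (hv0 : 0 ≤ v) (hv1 : v ≤ 1) :
    infidelity ψ ((1 - v) • ρ + v • noisyState d κ ψ) ≤ 1 - v * (1 - κ) := by
  have h1 : 0 ≤ (star ψ ⬝ᵥ (ρ *ᵥ ψ)).re :=
    (Complex.le_def.mp (hρ.1.dotProduct_mulVec_nonneg ψ)).1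
  have h2 : star ψ ⬝ᵥ (noisyState d κ ψ *ᵥ ψ) = ((κ / d + (1 - κ) : ℝ) : ℂ) := by
    rw [noisyState, Matrix.add_mulVec, Matrix.smul_mulVec, Matrix.smul_mulVec, Matrix.one_mulVec,
      Matrix.vecMulVec_mulVec, hψ, dotProduct_add, dotProduct_smul, dotProduct_smul]
    simp [hψ]
  have h3 : 0 ≤ κ / d := by positivity
  rw [infidelity, Matrix.add_mulVec, Matrix.smul_mulVec, Matrix.smul_mulVec, dotProduct_add,
    dotProduct_smul, dotProduct_smul, h2, Complex.add_re, Complex.smul_re, Complex.smul_re,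
    Complex.ofReal_re, smul_eq_mul, smul_eq_mul]
  nlinarith [mul_nonneg (sub_nonneg.mpr hv1) h1, mul_nonneg hv0 h3]

end Segment

/-! ### The number of steps -/

section Steps

open Real

theorem exp_two_le : exp 2 ≤ 2 * (exp 1 + 1) := by
  have h : exp 2 = exp 1 * exp 1 := by rw [← exp_add]; norm_num
  have := exp_one_lt_d9
  have := exp_one_gt_d9
  rw [h]
  nlinarith

theorem two_le_log_div {ε η : ℝ} (hε : 0 < ε) (hε' : ε ≤ 1 / 2) (hη : 0 < η) (hη' : η ≤ 1) :
    2 ≤ log ((exp 1 + 1) / (ε * η)) := by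
  have hp : 0 < ε * η := mul_pos hε hη
  rw [le_log_iff_exp_le (by positivity), le_div_iff₀ hp]
  have h1 : ε * η ≤ 1 / 2 := by nlinarith
  nlinarith [exp_two_le, exp_pos 2]

/-- The slack that pays for the first step being spent on mixing: the remaining `T - 1` steps have to
cover the whole logarithm. -/
theorem slack_le {ε η : ℝ} (hε : 0 < ε) (hε' : ε ≤ 1 / 2) (hη : 0 < η) (hη' : η ≤ 1) :
    η * (exp 1 / (exp 1 + 1))
      ≤ log ((exp 1 + 1) / (ε * η)) * (ε / (1 + ε) + η / (exp 1 + 1 + η)) := by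
  have hE1 := exp_one_lt_d9
  have hE2 := exp_one_gt_d9
  set E := exp 1 with hE
  have hlog2 := two_le_log_div hε hε' hη hη'
  -- Since `e² ≤ 2 (e + 1)`, the logarithm is at least `3 - ln (2 e ε)`; take the tangent of `ln` at 1.
  have hlog4 : 4 - 2 * E * ε ≤ log ((E + 1) / (ε * η)) := by
    have h1 : exp 3 / (2 * E * ε) ≤ (E + 1) / (ε * η) := by
      have h3 : exp 3 = exp 2 * E := by rw [hE, ← exp_add]; norm_num
      rw [h3, div_le_div_iff₀ (by positivity) (by positivity)]
      have h4 : exp 2 * E * (ε * η) ≤ exp 2 * E * (ε * 1) := by gcongr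
      have h5 : exp 2 * (E * ε) ≤ 2 * (E + 1) * (E * ε) := by
        gcongr
        exact exp_two_le
      nlinarith
    have h2 := log_le_log (by positivity) h1
    rw [log_div (exp_pos 3).ne' (by positivity), log_exp] at h2
    linarith [log_le_sub_one_of_pos (show 0 < 2 * E * ε by positivity)]
  set Λ := log ((E + 1) / (ε * η))
  have ha : E / (E + 1) ≤ 0.7312 := by
    rw [div_le_iff₀ (by positivity)]; linarith
  have hb : η * 0.2119 ≤ η / (E + 1 + η) := by
    rw [div_eq_mul_inv]
    refine mul_le_mul_of_nonneg_left ?_ hη.le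
    rw [le_inv_comm₀ (by norm_num) (by positivity)]
    norm_num
    linarith
  have hc : η * (ε / (1 + ε)) ≤ ε / (1 + ε) :=
    mul_le_of_le_one_left (by positivity) hη'
  have hmain : 0.7312 ≤ Λ * (ε / (1 + ε) + 0.2119) := by
    rcases le_or_gt (1 / 5) ε with h | h
    · have h1 : 1 / 6 ≤ ε / (1 + ε) := by
        rw [le_div_iff₀ (by positivity)]; linarith
      nlinarith
    · have h1 : ε * (5 / 6) ≤ ε / (1 + ε) := by
        rw [le_div_iff₀ (by positivity)]; nlinarith
      have h2 : 4 - 5.44 * ε ≤ Λ := by nlinarith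
      have h3 : (4 - 5.44 * ε) * (ε * (5 / 6) + 0.2119) ≤ Λ * (ε / (1 + ε) + 0.2119) := by
        gcongr
      nlinarith
  calc η * (E / (E + 1)) ≤ η * (Λ * (ε / (1 + ε) + 0.2119)) := by gcongr; linarith
    _ = Λ * (η * (ε / (1 + ε)) + η * 0.2119) := by ring
    _ ≤ Λ * (ε / (1 + ε) + η / (E + 1 + η)) := by gcongr

/-- The heat budget for `m + 1` steps: the first costs `η / (e + 1)`, the others together `Λ / m` times
the change of weight, with `Λ = ln ((e + 1) / (ε η))`. -/
theorem heat_budget {ε η m : ℝ} (hε : 0 < ε) (hε' : ε ≤ 1 / 2) (hη : 0 < η) (hη' : η ≤ 1)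
    (hm : 0 < m)
    (hT : (exp 1 + 1) / (exp 1 * η) * log ((exp 1 + 1) / (ε * η)) ≤ m + 1) :
    η / (exp 1 + 1) + log ((exp 1 + 1) / (ε * η)) / m
        * (1 / (1 + ε) - η / (exp 1 + 1) / (1 + η / (exp 1 + 1))) ≤ η := by
  have hs := slack_le hε hε' hη hη'
  have hE := exp_pos 1
  set E := exp 1
  set Λ := log ((E + 1) / (ε * η))
  have hb : η * (E / (E + 1)) = η - η / (E + 1) := by field_simp; ring
  have hΛ : Λ ≤ η * (E / (E + 1)) * (m + 1) := by
    have h := mul_le_mul_of_nonneg_left hT (show 0 ≤ η * (E / (E + 1)) by positivity)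
    have e : η * (E / (E + 1)) * ((E + 1) / (E * η) * Λ) = Λ := by field_simp
    rwa [e] at h
  have e1 : η / (E + 1) / (1 + η / (E + 1)) = η / (E + 1 + η) := by field_simp
  have e2 : 1 / (1 + ε) = 1 - ε / (1 + ε) := by field_simp; ring
  rw [e1, e2]
  have h1 : Λ * (1 - ε / (1 + ε) - η / (E + 1 + η)) ≤ η * (E / (E + 1)) * m := by nlinarith
  have h2 : Λ / m * (1 - ε / (1 + ε) - η / (E + 1 + η)) ≤ η * (E / (E + 1)) := by
    rw [div_mul_eq_mul_div, div_le_iff₀ hm]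
    exact h1
  linarith

theorem le_erasureSteps {d : ℕ} (hd : 2 ≤ d) {ε η : ℝ} (hε : 0 < ε) (hη : 0 < η) :
    (exp 1 + 1) / (exp 1 * η) * log ((exp 1 + 1) / (ε * η)) ≤ erasureSteps d ε η := by
  refine le_trans ?_ (Nat.le_ceil _)
  have hd' : (2 : ℝ) ≤ d := by exact_mod_cast hd
  have hE := exp_pos 1
  have hd1 : 1 ≤ ((d : ℝ) - 1) ^ 2 := one_le_pow₀ (by linarith)
  gcongr
  exact le_mul_of_one_le_right (by positivity) hd1

theorem erasureSteps_le {d : ℕ} (hd : 2 ≤ d) {ε η : ℝ} (hε : 0 < ε) (hε' : ε ≤ 1 / 2) (hη : 0 < η)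
    (hη' : η ≤ 1) :
    (erasureSteps d ε η : ℝ) ≤ 5 * (1 / η * log ((d : ℝ) ^ 2 / (ε * η))) := by
  have hd' : (2 : ℝ) ≤ d := by exact_mod_cast hd
  have hE1 := exp_one_lt_d9
  have hE2 := exp_one_gt_d9
  have hp : 0 < ε * η := mul_pos hε hη
  have hp' : ε * η ≤ 1 / 2 := by nlinarith
  have hEp : exp 1 + 1 ≤ exp 2 := by
    have h : exp 2 = exp 1 * exp 1 := by rw [← exp_add]; norm_num
    nlinarith
  have hM : 2 ≤ log ((d : ℝ) ^ 2 / (ε * η)) := by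
    rw [le_log_iff_exp_le (by positivity), le_div_iff₀ hp]
    nlinarith [exp_two_le, exp_pos 2]
  have hL : log ((exp 1 + 1) * ((d : ℝ) - 1) ^ 2 / (ε * η))
      ≤ 2 + log ((d : ℝ) ^ 2 / (ε * η)) := by
    have h1 : (exp 1 + 1) * ((d : ℝ) - 1) ^ 2 / (ε * η) ≤ exp 2 * ((d : ℝ) ^ 2 / (ε * η)) := by
      rw [mul_div_assoc]
      gcongr
      · linarith
      · linarith
    have hpos : 0 < (exp 1 + 1) * ((d : ℝ) - 1) ^ 2 / (ε * η) := by
      have : 0 < (d : ℝ) - 1 := by linarith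
      positivity
    have h2 := log_le_log hpos h1
    rwa [log_mul (exp_pos 2).ne' (by positivity), log_exp] at h2
  have hL0 : 0 ≤ log ((exp 1 + 1) * ((d : ℝ) - 1) ^ 2 / (ε * η)) := by
    refine log_nonneg ?_
    rw [le_div_iff₀ hp]
    nlinarith
  have hnn : 0 ≤ (exp 1 + 1) / (exp 1 * η)
      * log ((exp 1 + 1) * ((d : ℝ) - 1) ^ 2 / (ε * η)) := by positivity
  refine (Nat.ceil_lt_add_one hnn).le.trans ?_
  set M := log ((d : ℝ) ^ 2 / (ε * η))
  have ha : (exp 1 + 1) / (exp 1 * η) ≤ 2 * (1 / η) := by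
    rw [div_le_iff₀ (by positivity)]
    field_simp
    linarith
  have hη1 : 1 ≤ 1 / η := by rw [le_div_iff₀ hη]; linarith
  calc _ ≤ 2 * (1 / η) * (2 + M) + 1 := by gcongr
    _ ≤ 5 * (1 / η * M) := by
      nlinarith [mul_nonneg (by linarith : 0 ≤ 1 / η) (by linarith : 0 ≤ M - 2)]

end Steps

theorem theorem1 :
    (∀ (d : ℕ), 2 ≤ d →
      ∀ (ρS : Matrix (Fin d) (Fin d) ℂ), IsDensity ρS →
      ∀ (ψ : Fin d → ℂ), star ψ ⬝ᵥ ψ = 1 →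
      ∀ (ε η β : ℝ), 0 < ε → ε ≤ 1 / 2 → 0 < η → η ≤ 1 → 0 < β →
        ∃ P : SwapErasureProtocol ρS (erasureSteps d ε η),
          infidelity ψ (P.finalState β) ≤ ε ∧
          β * P.heat β - P.entropyDrop β ≤ η) ∧
    (∃ C : ℝ, 0 < C ∧
      ∀ (d : ℕ) (ε η : ℝ), 2 ≤ d → 0 < ε → ε ≤ 1 / 2 → 0 < η → η ≤ 1 →
        (erasureSteps d ε η : ℝ) ≤ C * (1 / η * Real.log ((d : ℝ) ^ 2 / (ε * η)))) := by
  refine ⟨fun d hd ρS hρ ψ hψ ε η β hε hε' hη hη' hβ => ?_,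
    5, by norm_num, fun d ε η hd hε hε' hη hη' => erasureSteps_le hd hε hε' hη hη'⟩
  have hE := Real.exp_pos 1
  have hT := le_erasureSteps hd hε hη
  have hΛ := two_le_log_div hε hε' hη hη'
  have hT2 : 2 ≤ erasureSteps d ε η := by
    have h1 : 1 ≤ (Real.exp 1 + 1) / (Real.exp 1 * η) := by
      rw [le_div_iff₀ (by positivity)]
      nlinarith
    have h2 : (2 : ℝ) ≤ erasureSteps d ε η := by nlinarith
    exact_mod_cast h2
  obtain ⟨m, hm⟩ : ∃ m, erasureSteps d ε η = m + 1 := ⟨erasureSteps d ε η - 1, by omega⟩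
  rw [hm] at hT hT2 ⊢
  have hm0 : (0 : ℝ) < m := by exact_mod_cast (by omega : 0 < m)
  push_cast at hT
  set Λ := Real.log ((Real.exp 1 + 1) / (ε * η)) with hΛdef
  have hκ0 : 0 < ε ^ 2 := by positivity
  have hκ1 : ε ^ 2 ≤ 1 := by nlinarith
  have hd0 : 0 < d := by omega
  have hv1 : 1 / (1 + ε) < 1 := by rw [div_lt_one (by positivity)]; linarith
  -- The odds of the weight grow from `η / (e + 1)` to `1 / ε`, a factor `exp Λ`.
  have hodds : 1 / (1 + ε) / (1 - 1 / (1 + ε))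
      = η / (Real.exp 1 + 1) * Real.exp (Λ / m * m) := by
    rw [div_mul_cancel₀ _ hm0.ne', hΛdef, Real.exp_log (by positivity)]
    have e : 1 - 1 / (1 + ε) = ε / (1 + ε) := by field_simp; ring
    rw [e]
    field_simp
  obtain ⟨P, hP, hheat⟩ := exists_protocol_of_geometric_odds hρ
    (noisyState_isDensity hd0 hκ0 hκ1 hψ) (noisyState_posDef hd0 hκ0 hκ1 ψ)
    (div_pos hκ0 (by exact_mod_cast hd0 : (0 : ℝ) < d)) (noisyState_sub_posSemidef hκ1 ψ) m
    (show 0 < η / (Real.exp 1 + 1) by positivity) (show 0 < Λ / m from div_pos (by linarith) hm0)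
    hβ hodds hv1
  refine ⟨P, ?_, hheat.trans (heat_budget hε hε' hη hη' hm0 hT)⟩
  rw [hP]
  refine (infidelity_segment_noisyState_le hκ0.le hψ hρ (by positivity) hv1.le).trans
    (le_of_eq ?_)
  field_simp
  ring
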